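/- Let $\mathcal H$ be a real separable Hilbert space and $\mathbf I$ its identity operator. Let $\mathbf X,\mathbf Y,\mathbf M$ be self-adjoint Hilbert–Schmidt operators on $\mathcal H$, and let $\delta,\gamma\ge 0$ and $\rho>0$ be such that $\mathbf X+\delta\mathbf I$, $\mathbf Y+\gamma\mathbf I$ and $\mathbf M+\rho\mathbf I$ are positive definite, i.e. each is bounded below by a positive multiple of $\mathbf I$. Put $S=\mathbf X+\delta\mathbf I$, $T=\mathbf Y+\gamma\mathbf I$ and $N=(\mathbf M+\rho\mathbf I)^{-1}$. For a bounded operator $A$ and an orthonormal basis $(e_i)$ of $\mathcal H$ let $\operatorname{tr}A=\sum_i\langle e_i,Ae_i\rangle$, read as the sum of the positive parts of the terms minus the sum of their negative parts, with value $+\infty$ if only the former sum is infinite. The extended Mahalanobis norm is $\|A\|_{\mathbf M_\infty^{-1}}=\sqrt{\operatorname{tr}(A^*NA)}\in[0,\infty]$. For $\alpha>0$ the infinite-dimensional generalised $\alpha$-Procrustes distance is $$d^{\alpha}_{\mathrm{ProM}_\infty}[S,T]=\inf_{\mathbf I+\mathbf U\in\mathbb U(\mathcal H)}\left\|\frac{S^{\alpha}-T^{\alpha}(\mathbf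 I+\mathbf U)}{\alpha}\right\|_{\mathbf M_\infty^{-1}},$$ where $\mathbb U(\mathcal H)$ is the set of unitary operators on $\mathcal H$. The infinite-dimensional generalised Bures–Wasserstein distance is $$d_{\mathrm{GBW}_\infty}[S,T]=\Big(\operatorname{tr}\big[\,NS+NT-2\,(S^{1/2}\,N\,T\,N\,S^{1/2})^{1/2}\,\big]\Big)^{1/2}\in[0,\infty].$$ Then, whichever orthonormal basis is used for the traces, the trace under the last root is well defined and nonnegative, the infimum for $\alpha=1/2$ is attained, and $$d^{1/2}_{\mathrm{ProM}_\infty}[S,T]=2\,d_{\mathrm{GBW}_\infty}[S,T].$$ Moreover, $d_{\mathrm{GBW}_\infty}[S,T]$ is finite if and only if $\dim\mathcal H<\infty$ or $\delta=\gamma$. -/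

import Mathlib

open scoped ENNReal

namespace ProcrustesGBW

section

variable {H : Type*} [NormedAddCommGroup H] [InnerProductSpace ℝ H]

/-- `A` is a Hilbert-Schmidt operator: `∑ ‖A eᵢ‖² < ∞` for an orthonormal (Hilbert) basis `e`
(equivalently, for every one). -/
def IsHilbertSchmidt (A : H →L[ℝ] H) : Prop :=
  ∃ (s : Set H) (e : HilbertBasis s ℝ H), Summable fun i => ‖A (e i)‖ ^ 2

/-- `A` belongs to `ℙ(H)`: it is self-adjoint and bounded below by a positive multiple of the
identity. -/
def IsPosDef [CompleteSpace H] (A : H →L[ℝ] H) : Prop :=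
  IsSelfAdjoint A ∧ ∃ c : ℝ, 0 < c ∧ ∀ x : H, c * ‖x‖ ^ 2 ≤ inner ℝ x (A x)

/-- The pair `(A, δ)` represents an element `A + δ I` of the set of positive definite extended
(unitized) Hilbert-Schmidt operators. -/
def IsPosDefExtHS [CompleteSpace H] (A : H →L[ℝ] H) (δ : ℝ) : Prop :=
  IsSelfAdjoint A ∧ IsHilbertSchmidt A ∧ 0 ≤ δ ∧ IsPosDef (A + δ • (1 : H →L[ℝ] H))

/-- `A` is the real power `T ^ α` of an operator `T` that is diagonalizable, i.e. whose
eigenvectors span a dense subspace (for instance a self-adjoint Hilbert-Schmidt operator plus a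
multiple of the identity): `A v = μ ^ α v` for every eigenvector `v` of `T` with eigenvalue `μ`. -/
def IsOpPow (T : H →L[ℝ] H) (α : ℝ) (A : H →L[ℝ] H) : Prop :=
  (⨆ μ : ℝ, Module.End.eigenspace (T : H →ₗ[ℝ] H) μ).topologicalClosure = ⊤ ∧
    ∀ (μ : ℝ) (v : H), T v = μ • v → A v = (μ ^ α) • v

/-- A diagonalizable operator has at most one `α`-th power. -/
theorem IsOpPow.unique {T A B : H →L[ℝ] H} {α : ℝ} (hA : IsOpPow T α A) (hB : IsOpPow T α B) :
    A = B := by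
  have hle : (⨆ μ : ℝ, Module.End.eigenspace (T : H →ₗ[ℝ] H) μ) ≤
      LinearMap.eqLocus (A : H →ₗ[ℝ] H) (B : H →ₗ[ℝ] H) := by
    refine iSup_le fun μ v hv => ?_
    have hv' : T v = μ • v := by simpa [Module.End.mem_eigenspace_iff] using hv
    have h : A v = B v := by rw [hA.2 μ v hv', hB.2 μ v hv']
    simpa [LinearMap.mem_eqLocus] using h
  have hcl : IsClosed ((LinearMap.eqLocus (A : H →ₗ[ℝ] H) (B : H →ₗ[ℝ] H) : Submodule ℝ H) :
      Set H) := isClosed_eq A.continuous B.continuous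
  have htop := Submodule.topologicalClosure_minimal _ hle hcl
  rw [hA.1] at htop
  ext v
  simpa [LinearMap.mem_eqLocus] using htop (Submodule.mem_top (x := v))

open Classical in
/-- The real power `T ^ α` of a diagonalizable operator `T` (the zero operator if there is no such
bounded operator). -/
noncomputable def opPow (T : H →L[ℝ] H) (α : ℝ) : H →L[ℝ] H :=
  if h : ∃ A, IsOpPow T α A then h.choose else 0

/-- The trace `∑ ⟨eᵢ, A eᵢ⟩` with respect to the orthonormal basis `e`, as an extended real number:
the sum of the positive parts of the terms minus the sum of their negative parts. It is the usual
trace when `A` is trace class, it is the usual `[0, ∞]`-valued trace when `A` is positive, and it is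
`⊥` when both sums are infinite. -/
noncomputable def opTrace {ι : Type*} (e : HilbertBasis ι ℝ H) (A : H →L[ℝ] H) : EReal :=
  ((∑' i, ENNReal.ofReal (inner ℝ (e i) (A (e i))) : ℝ≥0∞) : EReal) -
    ((∑' i, ENNReal.ofReal (-inner ℝ (e i) (A (e i))) : ℝ≥0∞) : EReal)

/-- The weight `(M + ρ I)⁻¹`. -/
noncomputable def weight (M : H →L[ℝ] H) (ρ : ℝ) : H →L[ℝ] H :=
  Ring.inverse (M + ρ • (1 : H →L[ℝ] H))

/-- The extended Mahalanobis norm `√(tr (T* (M + ρ I)⁻¹ T))`, with values in `[0, ∞]`. -/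
noncomputable def extMahalanobisNorm [CompleteSpace H] {ι : Type*} (e : HilbertBasis ι ℝ H)
    (M : H →L[ℝ] H) (ρ : ℝ) (T : H →L[ℝ] H) : ℝ≥0∞ :=
  (opTrace e (ContinuousLinearMap.adjoint T * weight M ρ * T)).toENNReal ^ (1 / 2 : ℝ)

/-- The quantity `‖(S ^ α - T ^ α (I + U)) / α‖` (extended Mahalanobis norm) that is minimized in
the generalised `α`-Procrustes distance between `S` and `T`. -/
noncomputable def procrustesCost [CompleteSpace H] {ι : Type*} (e : HilbertBasis ι ℝ H)
    (M : H →L[ℝ] H) (ρ : ℝ) (α : ℝ) (S T U : H →L[ℝ] H) : ℝ≥0∞ :=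
  extMahalanobisNorm e M ρ (α⁻¹ • (opPow S α - opPow T α * (1 + U)))

/-- The generalised `α`-Procrustes distance between `S` and `T`: the infimum of the cost over all
`U` such that `I + U` is unitary. -/
noncomputable def procrustesDist [CompleteSpace H] {ι : Type*} (e : HilbertBasis ι ℝ H)
    (M : H →L[ℝ] H) (ρ : ℝ) (α : ℝ) (S T : H →L[ℝ] H) : ℝ≥0∞ :=
  ⨅ (U : H →L[ℝ] H) (_ : 1 + U ∈ unitary (H →L[ℝ] H)), procrustesCost e M ρ α S T U

/-- With `N = (M + ρ I)⁻¹`, the squared generalised Bures-Wasserstein distance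
`tr (N S) + tr (N T) - 2 tr (S^{1/2} N T N S^{1/2})^{1/2}`. In infinite dimension each of the
three traces is infinite for positive definite `S` and `T`, so the trace is taken of the
combined operator. -/
noncomputable def gbwSq {ι : Type*} (e : HilbertBasis ι ℝ H)
    (M : H →L[ℝ] H) (ρ : ℝ) (S T : H →L[ℝ] H) : EReal :=
  opTrace e (weight M ρ * S + weight M ρ * T -
    (2 : ℝ) • opPow (opPow S (1 / 2) * weight M ρ * T * weight M ρ * opPow S (1 / 2)) (1 / 2))

/-- The generalised Bures-Wasserstein distance between `S` and `T`, with values in `[0, ∞]`. -/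
noncomputable def gbwDist {ι : Type*} (e : HilbertBasis ι ℝ H)
    (M : H →L[ℝ] H) (ρ : ℝ) (S T : H →L[ℝ] H) : ℝ≥0∞ :=
  (gbwSq e M ρ S T).toENNReal ^ (1 / 2 : ℝ)

end

end ProcrustesGBW

namespace ProcrustesGBW

set_option linter.unusedSectionVars false

/-! ### Hilbert–Schmidt operators: basis independence and ideal properties. -/

section HilbertSchmidt

variable {H : Type*} [NormedAddCommGroup H] [InnerProductSpace ℝ H]

/-! Write `R = S^{1/2}`, `Q = T^{1/2}`, `P = (R N T N R)^{1/2}`, so that `P = |Q N R|`, and let `Q N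
R = W P` be the polar decomposition; `W` is unitary since `Q N R` is invertible. For unitary `V`,
put `Z = W* V` and `G = N S + N T - 2 P`. Algebra (`star_mul_mul_decomposition`) gives `(R - Q V)* N
(R - Q V) = G + (1 - Z)* P (1 - Z) + commutators`. The middle term is positive and vanishes at `V =
W`. Hence, once the commutators have trace zero, `W` is a minimizer and the minimum is `tr G`. The
factor `1/α = 2` then gives the factor 2 in the theorem.

In infinite dimension the separate traces diverge, so the argument runs in the algebra of operators
"scalar plus Hilbert–Schmidt" (`IsExtHS`), which contains the square roots and inverses used here. A
commutator there equals that of the Hilbert–Schmidt parts, so its trace is zero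
(`IsExtHS.hasSum_commutator`). A competitor `V` need not lie in this algebra, but finite cost makes
`R - Q V` Hilbert–Schmidt, and then `V = Q⁻¹ (R - (R - Q V))` does.

Finiteness is decided by scalar parts. In infinite dimension `W` has scalar part 1, `R - Q W` has
`√δ - √γ`, and `G` has `ρ⁻¹ (√δ - √γ)²`. If `δ = γ`, the cost of `W` is finite. Otherwise `tr G =
∞`, and no unitary has finite cost because its scalar part would have to be 1. -/

theorem tsum_ofReal_inner_sq {ι : Type*} (b : HilbertBasis ι ℝ H) (x : H) :
    ∑' i, ENNReal.ofReal (inner ℝ (b i) x ^ 2) = ENNReal.ofReal (‖x‖ ^ 2) := by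
  have h := b.hasSum_inner_mul_inner x x
  have h' : HasSum (fun i => inner ℝ (b i) x ^ 2) (‖x‖ ^ 2) := by
    simpa only [real_inner_comm x, ← sq, real_inner_self_eq_norm_sq] using h
  rw [← ENNReal.ofReal_tsum_of_nonneg (fun i => sq_nonneg _) h'.summable, h'.tsum_eq]

theorem summable_iff_tsum_ofReal_ne_top {ι : Type*} {f : ι → ℝ} (hf : ∀ i, 0 ≤ f i) :
    Summable f ↔ ∑' i, ENNReal.ofReal (f i) ≠ ⊤ := by
  constructor
  · intro h
    rw [← ENNReal.ofReal_tsum_of_nonneg hf h]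
    exact ENNReal.ofReal_ne_top
  · intro h
    refine (ENNReal.summable_toReal h).congr fun i => ?_
    rw [ENNReal.toReal_ofReal (hf i)]

variable [CompleteSpace H]

/-- By Parseval, both sides are the double sum of `⟨c j, A (b i)⟩²`, and Tonelli exchanges the sums.
Two applications show that the Hilbert–Schmidt sum does not depend on the basis. -/
theorem tsum_ofReal_norm_sq_adjoint {ι κ : Type*} (b : HilbertBasis ι ℝ H)
    (c : HilbertBasis κ ℝ H) (A : H →L[ℝ] H) :
    ∑' i, ENNReal.ofReal (‖A (b i)‖ ^ 2) =
      ∑' j, ENNReal.ofReal (‖ContinuousLinearMap.adjoint A (c j)‖ ^ 2) := by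
  simp_rw [← tsum_ofReal_inner_sq c (A _), ← tsum_ofReal_inner_sq b (ContinuousLinearMap.adjoint A _)]
  rw [ENNReal.tsum_comm]
  simp_rw [ContinuousLinearMap.adjoint_inner_right, real_inner_comm]

theorem IsHilbertSchmidt.summable {ι : Type*} (b : HilbertBasis ι ℝ H) {A : H →L[ℝ] H}
    (hA : IsHilbertSchmidt A) : Summable fun i => ‖A (b i)‖ ^ 2 := by
  obtain ⟨s, e, he⟩ := hA
  rw [summable_iff_tsum_ofReal_ne_top fun i => sq_nonneg _] at he ⊢
  rwa [tsum_ofReal_norm_sq_adjoint b b, ← tsum_ofReal_norm_sq_adjoint e b]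

theorem isHilbertSchmidt_of_summable {ι : Type*} (b : HilbertBasis ι ℝ H) {A : H →L[ℝ] H}
    (hA : Summable fun i => ‖A (b i)‖ ^ 2) : IsHilbertSchmidt A := by
  obtain ⟨s, e, -⟩ := exists_hilbertBasis ℝ H
  refine ⟨s, e, ?_⟩
  rw [summable_iff_tsum_ofReal_ne_top fun i => sq_nonneg _] at hA ⊢
  rwa [tsum_ofReal_norm_sq_adjoint e b, ← tsum_ofReal_norm_sq_adjoint b b]

theorem IsHilbertSchmidt.adjoint {A : H →L[ℝ] H} (hA : IsHilbertSchmidt A) :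
    IsHilbertSchmidt (star A) := by
  obtain ⟨s, e, he⟩ := hA
  refine ⟨s, e, ?_⟩
  rw [summable_iff_tsum_ofReal_ne_top fun i => sq_nonneg _] at he ⊢
  rwa [ContinuousLinearMap.star_eq_adjoint, ← tsum_ofReal_norm_sq_adjoint e e]

theorem IsHilbertSchmidt.mul_left {A : H →L[ℝ] H} (hA : IsHilbertSchmidt A) (B : H →L[ℝ] H) :
    IsHilbertSchmidt (B * A) := by
  obtain ⟨s, e, he⟩ := hA
  refine ⟨s, e, (he.mul_left (‖B‖ ^ 2)).of_nonneg_of_le (fun i => sq_nonneg _) fun i => ?_⟩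
  rw [← mul_pow]
  exact pow_le_pow_left₀ (norm_nonneg _) (B.le_opNorm _) 2

theorem IsHilbertSchmidt.mul_right {A : H →L[ℝ] H} (hA : IsHilbertSchmidt A) (B : H →L[ℝ] H) :
    IsHilbertSchmidt (A * B) := by
  have := (hA.adjoint.mul_left (star B)).adjoint
  rwa [← star_mul, star_star] at this

theorem IsHilbertSchmidt.smul {A : H →L[ℝ] H} (hA : IsHilbertSchmidt A) (c : ℝ) :
    IsHilbertSchmidt (c • A) := by
  simpa using hA.mul_left (c • (1 : H →L[ℝ] H))

theorem IsHilbertSchmidt.add {A B : H →L[ℝ] H} (hA : IsHilbertSchmidt A)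
    (hB : IsHilbertSchmidt B) : IsHilbertSchmidt (A + B) := by
  obtain ⟨s, e, he⟩ := hA
  refine ⟨s, e, ((he.add (hB.summable e)).mul_left 2).of_nonneg_of_le (fun i => sq_nonneg _)
    fun i => ?_⟩
  have h := norm_add_le (A (e i)) (B (e i))
  rw [add_apply]
  nlinarith [norm_nonneg (A (e i) + B (e i)), sq_nonneg (‖A (e i)‖ - ‖B (e i)‖)]

theorem IsHilbertSchmidt.sub {A B : H →L[ℝ] H} (hA : IsHilbertSchmidt A)
    (hB : IsHilbertSchmidt B) : IsHilbertSchmidt (A - B) := by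
  simpa [sub_eq_add_neg] using hA.add (hB.smul (-1))

theorem isHilbertSchmidt_zero : IsHilbertSchmidt (0 : H →L[ℝ] H) := by
  obtain ⟨s, e, -⟩ := exists_hilbertBasis ℝ H
  exact ⟨s, e, by simp⟩

theorem finite_index_of_finiteDimensional [FiniteDimensional ℝ H] {ι : Type*}
    (b : HilbertBasis ι ℝ H) : Finite ι :=
  b.orthonormal.linearIndependent.finite

theorem isHilbertSchmidt_of_finiteDimensional [FiniteDimensional ℝ H] (A : H →L[ℝ] H) :
    IsHilbertSchmidt A := by
  obtain ⟨s, e, -⟩ := exists_hilbertBasis ℝ H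
  have := finite_index_of_finiteDimensional e
  exact ⟨s, e, Summable.of_finite⟩

theorem finiteDimensional_of_finite_index {ι : Type*} [Finite ι]
    (b : HilbertBasis ι ℝ H) : FiniteDimensional ℝ H := by
  have := Fintype.ofFinite ι
  exact b.toOrthonormalBasis.toBasis.finiteDimensional_of_finite

theorem isHilbertSchmidt_one_iff : IsHilbertSchmidt (1 : H →L[ℝ] H) ↔ FiniteDimensional ℝ H := by
  refine ⟨?_, fun _ => isHilbertSchmidt_of_finiteDimensional _⟩
  rintro ⟨s, e, he⟩
  have h1 : Summable fun _ : s => (1 : ℝ) := by simpa [e.orthonormal.norm_eq_one] using he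
  have : Finite s := by
    by_contra hs
    rw [not_finite_iff_infinite] at hs
    simp [summable_const_iff] at h1
  exact finiteDimensional_of_finite_index e

end HilbertSchmidt

/-! ### The algebra of scalars plus Hilbert–Schmidt operators. -/

section ExtHS

variable {H : Type*} [NormedAddCommGroup H] [InnerProductSpace ℝ H]

/-- `A` is the sum of `a` times the identity and a Hilbert-Schmidt operator. -/
def IsExtHS (A : H →L[ℝ] H) (a : ℝ) : Prop := IsHilbertSchmidt (A - a • (1 : H →L[ℝ] H))

variable [CompleteSpace H] {A B : H →L[ℝ] H} {a b : ℝ}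

theorem IsHilbertSchmidt.isExtHS (hA : IsHilbertSchmidt A) (a : ℝ) : IsExtHS (A + a • 1) a := by
  simpa [IsExtHS] using hA

theorem isExtHS_zero_iff : IsExtHS A 0 ↔ IsHilbertSchmidt A := by simp [IsExtHS]

theorem isExtHS_of_finiteDimensional [FiniteDimensional ℝ H] (A : H →L[ℝ] H) (a : ℝ) :
    IsExtHS A a := isHilbertSchmidt_of_finiteDimensional _

theorem IsExtHS.add (hA : IsExtHS A a) (hB : IsExtHS B b) : IsExtHS (A + B) (a + b) := by
  have := IsHilbertSchmidt.add hA hB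
  unfold IsExtHS
  convert this using 1
  module

theorem IsExtHS.smul (hA : IsExtHS A a) (c : ℝ) : IsExtHS (c • A) (c * a) := by
  have := IsHilbertSchmidt.smul hA c
  unfold IsExtHS
  convert this using 1
  module

theorem IsExtHS.sub (hA : IsExtHS A a) (hB : IsExtHS B b) : IsExtHS (A - B) (a - b) := by
  have := IsHilbertSchmidt.sub hA hB
  unfold IsExtHS
  convert this using 1
  module

theorem IsExtHS.mul (hA : IsExtHS A a) (hB : IsExtHS B b) : IsExtHS (A * B) (a * b) := by
  -- `AB - ab = (A - a) B + a (B - b)`.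
  have := (IsHilbertSchmidt.mul_right hA B).add ((IsHilbertSchmidt.smul hB a))
  unfold IsExtHS
  convert this using 1
  simp only [sub_mul, smul_mul_assoc, one_mul]
  module

theorem IsExtHS.star (hA : IsExtHS A a) : IsExtHS (star A) a := by
  have := IsHilbertSchmidt.adjoint hA
  simpa [IsExtHS] using this

/-- The scalar part of a left inverse. -/
theorem IsExtHS.left_inv (hA : IsExtHS A a) (h : B * A = 1) : IsExtHS B a⁻¹ := by
  by_cases ha : a = 0
  · subst ha
    -- With `a = 0` the identity `B A` is Hilbert–Schmidt, so `H` is finite-dimensional and any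
    -- scalar, even the default `0⁻¹ = 0`, is allowed.
    have h1 := IsHilbertSchmidt.mul_left hA B
    rw [zero_smul, sub_zero, h, isHilbertSchmidt_one_iff] at h1
    exact isExtHS_of_finiteDimensional _ _
  -- `B - a⁻¹ = -a⁻¹ B (A - a)`.
  · have h1 := (IsHilbertSchmidt.mul_left hA B).smul (-a⁻¹)
    unfold IsExtHS
    convert h1 using 1
    rw [mul_sub, h, mul_smul_comm, mul_one, smul_sub, smul_smul]
    simp [ha, sub_eq_add_neg, add_comm]

end ExtHS

/-! ### Hilbert–Schmidt operators are compact. -/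

section Compact

variable {H : Type*} [NormedAddCommGroup H] [InnerProductSpace ℝ H] [CompleteSpace H]

/-- The coordinates of `A x` are `⟨A* (b i), x⟩`; Cauchy–Schwarz bounds each one, and `A*` has the
same Hilbert–Schmidt sum as `A`. -/
theorem norm_apply_sq_le_tsum {ι : Type*} (b : HilbertBasis ι ℝ H) {A : H →L[ℝ] H}
    (hA : Summable fun i => ‖A (b i)‖ ^ 2) (x : H) :
    ‖A x‖ ^ 2 ≤ (∑' i, ‖A (b i)‖ ^ 2) * ‖x‖ ^ 2 := by
  have h0 : 0 ≤ ∑' i, ‖A (b i)‖ ^ 2 := tsum_nonneg fun i => sq_nonneg _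
  rw [← ENNReal.ofReal_le_ofReal_iff (by positivity), ENNReal.ofReal_mul h0,
    ENNReal.ofReal_tsum_of_nonneg (fun i => sq_nonneg _) hA, tsum_ofReal_norm_sq_adjoint b b,
    ← tsum_ofReal_inner_sq b, ← ENNReal.tsum_mul_right]
  refine ENNReal.tsum_le_tsum fun i => ?_
  rw [← ENNReal.ofReal_mul (sq_nonneg _), ← mul_pow, ← ContinuousLinearMap.adjoint_inner_left]
  exact ENNReal.ofReal_le_ofReal (sq_le_sq' (neg_le_of_abs_le (abs_real_inner_le_norm _ _))
    (real_inner_le_norm _ _))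

theorem opNorm_le_sqrt_tsum {ι : Type*} (b : HilbertBasis ι ℝ H) {A : H →L[ℝ] H}
    (hA : Summable fun i => ‖A (b i)‖ ^ 2) : ‖A‖ ≤ √(∑' i, ‖A (b i)‖ ^ 2) := by
  refine A.opNorm_le_bound (Real.sqrt_nonneg _) fun x => ?_
  have h := Real.sqrt_le_sqrt (norm_apply_sq_le_tsum b hA x)
  rwa [Real.sqrt_mul (tsum_nonneg fun i => sq_nonneg _), Real.sqrt_sq (norm_nonneg _),
    Real.sqrt_sq (norm_nonneg _)] at h

/-- The finite-rank truncations `F t` converge to `A` in operator norm, since the error is at most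
the square root of the tail of a convergent series. -/
theorem IsHilbertSchmidt.isCompactOperator {A : H →L[ℝ] H} (hA : IsHilbertSchmidt A) :
    IsCompactOperator A := by
  classical
  obtain ⟨s, b, hb⟩ := hA
  let F : Finset s → H →L[ℝ] H := fun t => ∑ i ∈ t, (innerSL ℝ (b i)).smulRight (A (b i))
  have hF : ∀ t j, F t (b j) = if j ∈ t then A (b j) else 0 := by
    intro t j
    simp only [F, sum_apply, ContinuousLinearMap.smulRight_apply,
      innerSL_apply_apply, orthonormal_iff_ite.mp b.orthonormal, ite_smul, one_smul, zero_smul,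
      Finset.sum_ite_eq']
  have hcomp : ∀ t, IsCompactOperator (F t) := by
    intro t
    simp only [F]
    induction t using Finset.induction_on with
    | empty => simpa using isCompactOperator_zero
    | insert i t hi ih =>
      rw [Finset.sum_insert hi]
      refine IsCompactOperator.add ?_ ih
      have h1 : IsCompactOperator (innerSL ℝ (b i)) :=
        isCompactOperator_of_locallyCompactSpace_dom (innerSL ℝ (b i))
      exact h1.clm_comp (ContinuousLinearMap.toSpanSingleton ℝ (A (b i)))
  have hdiff : ∀ t j, ‖(A - F t) (b j)‖ ^ 2 = ((t : Set s)ᶜ).indicator (fun j => ‖A (b j)‖ ^ 2) j := by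
    intro t j
    rw [sub_apply, hF]
    by_cases hj : j ∈ t <;> simp [hj]
  have hsum : ∀ t, Summable fun j => ‖(A - F t) (b j)‖ ^ 2 := by
    intro t
    simp_rw [hdiff]
    exact hb.indicator _
  have hlim : Filter.Tendsto F Filter.atTop (nhds A) := by
    rw [tendsto_iff_norm_sub_tendsto_zero]
    have h0 := (tendsto_tsum_compl_atTop_zero fun j => ‖A (b j)‖ ^ 2).sqrt
    rw [Real.sqrt_zero] at h0
    refine squeeze_zero (fun t => norm_nonneg _) (fun t => ?_) h0
    rw [norm_sub_rev]
    refine (opNorm_le_sqrt_tsum b (hsum t)).trans (le_of_eq ?_)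
    simp_rw [hdiff]
    rw [← tsum_subtype]
    rfl
  exact isCompactOperator_of_tendsto hlim (Filter.Eventually.of_forall hcomp)

end Compact

/-! ### Eigenbases and diagonal operators. -/

section Diagonal

universe u

variable {H : Type u} [NormedAddCommGroup H] [InnerProductSpace ℝ H] [CompleteSpace H]

theorem IsSelfAdjoint.inner_apply_comm {T : H →L[ℝ] H} (hT : IsSelfAdjoint T) (x y : H) :
    inner ℝ (T x) y = inner ℝ x (T y) := hT.isSymmetric x y

theorem isSelfAdjoint_of_inner {T : H →L[ℝ] H} (h : ∀ x y, inner ℝ (T x) y = inner ℝ x (T y)) :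
    IsSelfAdjoint T := ContinuousLinearMap.isSelfAdjoint_iff_isSymmetric.mpr h

theorem isSelfAdjoint_smul_one (a : ℝ) : IsSelfAdjoint (a • (1 : H →L[ℝ] H)) :=
  isSelfAdjoint_of_inner fun x y => by simp [inner_smul_left, inner_smul_right]

theorem HilbertBasis.ext_inner {ι : Type*} (b : HilbertBasis ι ℝ H) {x y : H}
    (h : ∀ i, inner ℝ (b i) x = inner ℝ (b i) y) : x = y := by
  apply b.repr.injective
  ext i
  rw [b.repr_apply_apply, b.repr_apply_apply, h]

/-- A self-adjoint Hilbert-Schmidt operator plus a multiple of the identity has an orthonormal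
basis of eigenvectors. -/
theorem IsExtHS.exists_eigenbasis {T : H →L[ℝ] H} {a : ℝ} (hT : IsExtHS T a)
    (hsa : IsSelfAdjoint T) :
    ∃ (ι : Type u) (b : HilbertBasis ι ℝ H) (μ : ι → ℝ), ∀ i, T (b i) = μ i • b i := by
  set K := T - a • (1 : H →L[ℝ] H) with hK
  have hKsa : IsSelfAdjoint K := hsa.sub (isSelfAdjoint_smul_one a)
  have hsym : (K : H →ₗ[ℝ] H).IsSymmetric := hKsa.isSymmetric
  have hc : IsCompactOperator K := IsHilbertSchmidt.isCompactOperator hT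
  have hbot := ContinuousLinearMap.orthogonalComplement_iSup_eigenspaces_eq_bot hc hsym
  have hfam := hsym.orthogonalFamily_eigenspaces
  have hclosed : ∀ μ : ℝ, CompleteSpace (Module.End.eigenspace (K : H →ₗ[ℝ] H) μ) := by
    intro μ
    have : IsClosed ((Module.End.eigenspace (K : H →ₗ[ℝ] H) μ : Submodule ℝ H) : Set H) := by
      have : ((Module.End.eigenspace (K : H →ₗ[ℝ] H) μ : Submodule ℝ H) : Set H) =
          {v | K v = μ • v} := by
        ext v
        simp
      rw [this]
      exact isClosed_eq K.continuous (continuous_const_smul μ)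
    exact this.completeSpace_coe
  -- Orthonormal bases of all eigenspaces, the kernel included, are glued together; the spectral
  -- theorem for the compact `K` makes the union total.
  choose w c hc using fun μ : ℝ =>
    exists_hilbertBasis ℝ (Module.End.eigenspace (K : H →ₗ[ℝ] H) μ)
  have hon := hfam.orthonormal_sigma_orthonormal fun μ => (c μ).orthonormal
  have hspan : (Submodule.span ℝ (Set.range fun p : Σ μ : ℝ, w μ =>
      (Module.End.eigenspace (K : H →ₗ[ℝ] H) p.1).subtypeₗᵢ (c p.1 p.2)))ᗮ = ⊥ := by
    rw [eq_bot_iff, ← hbot, ← Submodule.iInf_orthogonal]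
    refine le_iInf fun μ v hv => ?_
    rw [Submodule.mem_orthogonal'] at hv ⊢
    intro u hu
    have hu' := ((c μ).hasSum_repr ⟨u, hu⟩).mapL
      (Module.End.eigenspace (K : H →ₗ[ℝ] H) μ).subtypeL |>.mapL (innerSL ℝ v)
    refine hu'.unique (HasSum.congr_fun hasSum_zero fun i => ?_)
    have := hv _ (Submodule.subset_span ⟨⟨μ, i⟩, rfl⟩)
    simp only [Submodule.coe_subtypeₗᵢ, Submodule.subtype_apply] at this
    simp [this]
  refine ⟨_, HilbertBasis.mkOfOrthogonalEqBot hon hspan, fun p => p.1 + a, ?_⟩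
  rintro ⟨μ, i⟩
  rw [HilbertBasis.coe_mkOfOrthogonalEqBot]
  have h := Module.End.mem_eigenspace_iff.mp (c μ i).2
  have hKe : T = K + a • (1 : H →L[ℝ] H) := by simp [hK]
  rw [hKe, add_apply, add_smul]
  congr 1

/-- There is a bounded operator with prescribed bounded eigenvalues on an orthonormal basis. -/
theorem exists_diagonal {ι : Type*} (b : HilbertBasis ι ℝ H) (r : ι → ℝ) {C : ℝ}
    (hr : ∀ i, |r i| ≤ C) :
    ∃ R : H →L[ℝ] H, ∀ x i, inner ℝ (b i) (R x) = r i * inner ℝ (b i) x := by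
  have hmem : ∀ x : H, Memℓp (fun i => r i * b.repr x i) 2 := by
    intro x
    have h := (lp.memℓp (b.repr x)).summable (by norm_num)
    refine memℓp_gen ((h.mul_left (C ^ 2)).of_nonneg_of_le (fun i => by positivity) fun i => ?_)
    have h1 : |r i| ^ 2 ≤ C ^ 2 := pow_le_pow_left₀ (abs_nonneg _) (hr i) 2
    simp only [ENNReal.toReal_ofNat, Real.rpow_ofNat, norm_mul, mul_pow, Real.norm_eq_abs]
    gcongr
  let R : H →ₗ[ℝ] H :=
    { toFun := fun x => b.repr.symm ⟨_, hmem x⟩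
      map_add' := fun x y => by
        rw [← map_add]
        congr 1
        ext i
        change r i * (b.repr (x + y)) i = r i * b.repr x i + r i * b.repr y i
        rw [map_add, lp.coeFn_add, Pi.add_apply, mul_add]
      map_smul' := fun t x => by
        rw [RingHom.id_apply, ← map_smul]
        congr 1
        ext i
        simp [mul_left_comm] }
  have hR : ∀ x i, inner ℝ (b i) (R x) = r i * inner ℝ (b i) x := by
    intro x i
    rw [← b.repr_apply_apply, ← b.repr_apply_apply]
    simp [R]
  refine ⟨R.mkContinuous |C| fun x => ?_, hR⟩
  rw [← abs_norm (R x), ← abs_norm x, ← abs_mul, ← sq_le_sq, mul_pow,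
    ← ENNReal.ofReal_le_ofReal_iff (by positivity), ENNReal.ofReal_mul (by positivity),
    ← tsum_ofReal_inner_sq b, ← tsum_ofReal_inner_sq b, ← ENNReal.tsum_mul_left]
  refine ENNReal.tsum_le_tsum fun i => ?_
  rw [← ENNReal.ofReal_mul (by positivity), hR, mul_pow]
  refine ENNReal.ofReal_le_ofReal (mul_le_mul_of_nonneg_right ?_ (sq_nonneg _))
  exact sq_le_sq.mpr ((hr i).trans (le_abs_self C))

end Diagonal

/-! ### Positive definite operators and their square roots. -/

section SquareRoot

universe u

variable {H : Type u} [NormedAddCommGroup H] [InnerProductSpace ℝ H] [CompleteSpace H]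

theorem IsPosDef.isUnit {A : H →L[ℝ] H} (hA : IsPosDef A) : IsUnit A := by
  obtain ⟨-, c, hc, h⟩ := hA
  refine ContinuousLinearMap.isUnit_of_forall_le_norm_inner_map A (c := ⟨c, hc.le⟩) hc fun x => ?_
  rw [real_inner_comm, Real.norm_eq_abs, mul_comm]
  exact (h x).trans (le_abs_self _)

theorem IsPosDef.inner_nonneg {A : H →L[ℝ] H} (hA : IsPosDef A) (x : H) : 0 ≤ inner ℝ x (A x) := by
  obtain ⟨-, c, hc, h⟩ := hA
  exact le_trans (by positivity) (h x)

theorem IsPosDef.add_smul_one {A : H →L[ℝ] H} (hA : IsPosDef A) {a : ℝ} (ha : 0 ≤ a) :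
    IsPosDef (A + a • 1) := by
  obtain ⟨hsa, c, hc, h⟩ := hA
  refine ⟨hsa.add (isSelfAdjoint_smul_one a), c, hc, fun x => ?_⟩
  have : 0 ≤ a * ‖x‖ ^ 2 := by positivity
  simp [inner_add_right, inner_smul_right]
  linarith [h x]

/-- A two-sided congruence of a positive definite operator by an invertible one. -/
theorem IsPosDef.star_mul_mul {A B : H →L[ℝ] H} (hA : IsPosDef A) (hB : IsUnit B) :
    IsPosDef (star B * A * B) := by
  obtain ⟨hsa, c, hc, h⟩ := hA
  refine ⟨hsa.conjugate' B, ?_⟩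
  obtain ⟨⟨B, D, hBD, hDB⟩, rfl⟩ := hB
  -- The `+ 1` keeps the constant positive when `H` is trivial and `‖D‖ = 0`.
  have hx : ∀ x, ‖x‖ ≤ (‖D‖ + 1) * ‖B x‖ := by
    intro x
    have h1 : D (B x) = x := DFunLike.congr_fun hDB x
    calc ‖x‖ = ‖D (B x)‖ := by rw [h1]
      _ ≤ ‖D‖ * ‖B x‖ := D.le_opNorm _
      _ ≤ _ := by gcongr; simp
  refine ⟨c * ((‖D‖ + 1) ^ 2)⁻¹, by positivity, fun x => ?_⟩
  have h2 : inner ℝ x ((star B * A * B) x) = inner ℝ (B x) (A (B x)) := by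
    rw [ContinuousLinearMap.star_eq_adjoint]
    exact ContinuousLinearMap.adjoint_inner_right B x (A (B x))
  change _ ≤ inner ℝ x ((star B * A * B) x)
  rw [h2]
  refine le_trans ?_ (h (B x))
  rw [mul_assoc]
  refine mul_le_mul_of_nonneg_left ?_ hc.le
  rw [inv_mul_le_iff₀ (by positivity), ← mul_pow]
  exact pow_le_pow_left₀ (norm_nonneg _) (hx x) 2

theorem isPosDef_one : IsPosDef (1 : H →L[ℝ] H) :=
  ⟨.one _, 1, one_pos, fun x => by simp⟩

theorem IsPosDef.inverse {A : H →L[ℝ] H} (hA : IsPosDef A) : IsPosDef (Ring.inverse A) := by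
  have hu := hA.isUnit
  have hsa : star (Ring.inverse A) = Ring.inverse A := by
    rw [← Ring.inverse_star, hA.1.star_eq]
  have := hA.star_mul_mul (B := Ring.inverse A) hu.ringInverse
  rwa [hsa, Ring.inverse_mul_cancel _ hu, one_mul] at this

theorem IsExtHS.inverse {A : H →L[ℝ] H} {a : ℝ} (hA : IsExtHS A a) (hu : IsUnit A) :
    IsExtHS (Ring.inverse A) a⁻¹ :=
  hA.left_inv (Ring.inverse_mul_cancel _ hu)

/-- Positive definite square roots in the extended Hilbert-Schmidt algebra. -/
theorem IsPosDef.exists_sqrt {T : H →L[ℝ] H} {a : ℝ} (hT : IsPosDef T) (hext : IsExtHS T a) :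
    ∃ R, IsOpPow T (1 / 2) R ∧ IsPosDef R ∧ R * R = T := by
  obtain ⟨hsa, c, hc, h⟩ := hT
  obtain ⟨ι, b, μ, hμ⟩ := hext.exists_eigenbasis hsa
  have hT : ∀ x i, inner ℝ (b i) (T x) = μ i * inner ℝ (b i) x := by
    intro x i
    rw [← IsSelfAdjoint.inner_apply_comm hsa, hμ, inner_smul_left]
    rfl
  have hμc : ∀ i, c ≤ μ i := by
    intro i
    have := h (b i)
    simpa [hT, b.orthonormal.norm_eq_one, real_inner_self_eq_norm_sq] using this
  have hμC : ∀ i, μ i ≤ ‖T‖ := by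
    intro i
    have := T.le_opNorm (b i)
    rw [hμ, norm_smul, b.orthonormal.norm_eq_one, mul_one, mul_one] at this
    exact (le_abs_self _).trans this
  obtain ⟨R, hR⟩ := exists_diagonal b (fun i => √(μ i)) (C := √‖T‖) fun i => by
    rw [abs_of_nonneg (Real.sqrt_nonneg _)]
    exact Real.sqrt_le_sqrt (hμC i)
  have hexp : ∀ x y, HasSum (fun i => √(μ i) * (inner ℝ (b i) x * inner ℝ (b i) y))
      (inner ℝ x (R y)) := by
    intro x y
    refine (b.hasSum_inner_mul_inner x (R y)).congr_fun fun i => ?_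
    rw [hR, real_inner_comm]
    ring
  refine ⟨R, ⟨?_, fun ν v hv => ?_⟩, ⟨?_, √c, Real.sqrt_pos.mpr hc, fun x => ?_⟩, ?_⟩
  · refine top_le_iff.mp (b.dense_span.ge.trans (Submodule.topologicalClosure_mono ?_))
    rw [Submodule.span_le]
    rintro _ ⟨i, rfl⟩
    exact Submodule.mem_iSup_of_mem (μ i) (Module.End.mem_eigenspace_iff.mpr (hμ i))
  · refine HilbertBasis.ext_inner b fun i => ?_
    have h1 := hT v i
    rw [hv, inner_smul_right] at h1
    rw [hR, inner_smul_right, ← Real.sqrt_eq_rpow]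
    rcases eq_or_ne (inner ℝ (b i) v) 0 with h0 | h0
    · rw [h0, mul_zero, mul_zero]
    · rw [mul_right_cancel₀ h0 h1]
  · refine isSelfAdjoint_of_inner fun x y => ?_
    rw [real_inner_comm]
    refine (hexp y x).unique ((hexp x y).congr_fun fun i => ?_)
    ring
  · have h1 : HasSum (fun i => √c * (inner ℝ x (b i) * inner ℝ (b i) x)) (√c * ‖x‖ ^ 2) := by
      rw [← real_inner_self_eq_norm_sq]
      exact (b.hasSum_inner_mul_inner x x).mul_left _
    refine hasSum_le (fun i => ?_) h1 (hexp x x)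
    rw [real_inner_comm]
    exact mul_le_mul_of_nonneg_right (Real.sqrt_le_sqrt (hμc i)) (mul_self_nonneg _)
  · ext x
    refine HilbertBasis.ext_inner b fun i => ?_
    change inner ℝ (b i) (R (R x)) = _
    rw [hR, hR, hT, ← mul_assoc,
      Real.mul_self_sqrt (hc.le.trans (hμc i))]

theorem opPow_eq {T A : H →L[ℝ] H} {α : ℝ} (h : IsOpPow T α A) : opPow T α = A := by
  have hex : ∃ A, IsOpPow T α A := ⟨A, h⟩
  rw [opPow, dif_pos hex]
  exact hex.choose_spec.unique h

theorem IsPosDef.isPosDef_opPow_half {T : H →L[ℝ] H} {a : ℝ} (hT : IsPosDef T)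
    (hext : IsExtHS T a) : IsPosDef (opPow T (1 / 2)) := by
  obtain ⟨R, h1, h2, -⟩ := hT.exists_sqrt hext
  rwa [opPow_eq h1]

theorem IsPosDef.opPow_half_mul_self {T : H →L[ℝ] H} {a : ℝ} (hT : IsPosDef T)
    (hext : IsExtHS T a) : opPow T (1 / 2) * opPow T (1 / 2) = T := by
  obtain ⟨R, h1, -, h2⟩ := hT.exists_sqrt hext
  rwa [opPow_eq h1]

/-- The scalar part of a positive definite square root. -/
theorem IsPosDef.isExtHS_of_mul_self {R : H →L[ℝ] H} {a : ℝ} (hR : IsPosDef R) (ha : 0 ≤ a)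
    (hext : IsExtHS (R * R) a) : IsExtHS R √a := by
  have hu := (hR.add_smul_one (Real.sqrt_nonneg a)).isUnit
  have h := IsHilbertSchmidt.mul_right hext (Ring.inverse (R + √a • 1))
  unfold IsExtHS
  convert h using 1
  -- The second factor is invertible, so `R - √a` is the Hilbert–Schmidt operator `R² - a` times a
  -- bounded one.
  have h1 : R * R - a • 1 = (R - √a • 1) * (R + √a • (1 : H →L[ℝ] H)) := by
    conv_lhs => rw [← Real.mul_self_sqrt ha]
    simp only [sub_mul, mul_add, smul_mul_assoc, mul_smul_comm, mul_one, one_mul]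
    module
  rw [h1, mul_assoc, Ring.mul_inverse_cancel _ hu, mul_one]

theorem IsPosDef.isExtHS_opPow_half {T : H →L[ℝ] H} {a : ℝ} (hT : IsPosDef T) (ha : 0 ≤ a)
    (hext : IsExtHS T a) : IsExtHS (opPow T (1 / 2)) √a :=
  (hT.isPosDef_opPow_half hext).isExtHS_of_mul_self ha
    (by rwa [hT.opPow_half_mul_self hext])

end SquareRoot

/-! ### Traces and commutators. -/

section Trace

variable {H : Type*} [NormedAddCommGroup H] [InnerProductSpace ℝ H] {ι : Type*}

theorem opTrace_eq_tsum (e : HilbertBasis ι ℝ H) {A : H →L[ℝ] H}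
    (hA : Summable fun i => inner ℝ (e i) (A (e i))) :
    opTrace e A = ((∑' i, inner ℝ (e i) (A (e i)) : ℝ) : EReal) := by
  have key : ∀ f : ι → ℝ, Summable f → Summable (fun i => max (f i) 0) ∧
      ((∑' i, ENNReal.ofReal (f i) : ℝ≥0∞) : EReal) = ((∑' i, max (f i) 0 : ℝ) : EReal) := by
    intro f hf
    have hs : Summable fun i => max (f i) 0 :=
      hf.abs.of_nonneg_of_le (fun i => le_max_right _ _) fun i =>
        max_le (le_abs_self _) (abs_nonneg _)
    refine ⟨hs, ?_⟩
    have h0 : ∀ i, ENNReal.ofReal (f i) = ENNReal.ofReal (max (f i) 0) := fun i => by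
      rw [ENNReal.ofReal_max, ENNReal.ofReal_zero, max_eq_left zero_le]
    simp_rw [h0]
    rw [← ENNReal.ofReal_tsum_of_nonneg (fun i => le_max_right _ _) hs,
      EReal.coe_ennreal_ofReal, max_eq_left (tsum_nonneg fun i => le_max_right _ _)]
  obtain ⟨hp, hp'⟩ := key _ hA
  obtain ⟨hn, hn'⟩ := key _ hA.neg
  rw [opTrace, hp', hn', ← EReal.coe_sub, ← hp.tsum_sub hn]
  congr 2
  ext i
  rcases le_total 0 (inner ℝ (e i) (A (e i))) with h | h <;> simp [h]

theorem toENNReal_opTrace_of_nonneg (e : HilbertBasis ι ℝ H) {A : H →L[ℝ] H}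
    (hA : ∀ i, 0 ≤ inner ℝ (e i) (A (e i))) :
    (opTrace e A).toENNReal = ∑' i, ENNReal.ofReal (inner ℝ (e i) (A (e i))) := by
  have h0 : ∀ i, ENNReal.ofReal (-inner ℝ (e i) (A (e i))) = 0 := fun i =>
    ENNReal.ofReal_of_nonpos (neg_nonpos.mpr (hA i))
  simp [opTrace, h0]

variable [CompleteSpace H]

/-- Square-summable terms tend to zero, so the scalar part is visible along any infinite orthonormal
basis. -/
theorem IsExtHS.tendsto_norm_sub {A : H →L[ℝ] H} {a : ℝ} (hA : IsExtHS A a)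
    (e : HilbertBasis ι ℝ H) :
    Filter.Tendsto (fun i => ‖A (e i) - a • e i‖) Filter.cofinite (nhds 0) := by
  have h := (IsHilbertSchmidt.summable e hA).tendsto_cofinite_zero.sqrt
  simpa [Real.sqrt_sq] using h

/-- The trace of an extended Hilbert-Schmidt operator with positive scalar part is infinite in
infinite dimension. -/
theorem IsExtHS.opTrace_eq_top {A : H →L[ℝ] H} {a : ℝ} (hA : IsExtHS A a) (ha : 0 < a)
    (hfd : ¬ FiniteDimensional ℝ H) (e : HilbertBasis ι ℝ H) : opTrace e A = ⊤ := by
  have hinf : Infinite ι := by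
    rw [← not_finite_iff_infinite]
    exact fun _ => hfd (finiteDimensional_of_finite_index e)
  -- The diagonal entries tend to `a`. Only finitely many can be negative, and infinitely many are
  -- at least `a / 2`.
  have hfin : {i | inner ℝ (e i) (A (e i)) < a / 2}.Finite := by
    have h := (hA.tendsto_norm_sub e).eventually (gt_mem_nhds (half_pos ha))
    rw [Filter.eventually_cofinite] at h
    refine h.subset fun i hi => ?_
    simp only [Set.mem_ofPred_eq, not_lt] at hi ⊢
    have h1 := neg_le_of_abs_le (abs_real_inner_le_norm (e i) (A (e i) - a • e i))
    rw [inner_sub_right, inner_smul_right, real_inner_self_eq_norm_sq,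
      e.orthonormal.norm_eq_one] at h1
    linarith
  have hneg : ∑' i, ENNReal.ofReal (-inner ℝ (e i) (A (e i))) ≠ ⊤ := by
    rw [tsum_eq_sum (s := hfin.toFinset)]
    · exact ENNReal.sum_ne_top.mpr fun i _ => ENNReal.ofReal_ne_top
    · intro i hi
      rw [Set.Finite.mem_toFinset, Set.mem_ofPred_eq, not_lt] at hi
      exact ENNReal.ofReal_of_nonpos (by linarith)
  have hpos : ∑' i, ENNReal.ofReal (inner ℝ (e i) (A (e i))) = ⊤ := by
    by_contra htop
    have h := ENNReal.finite_const_le_of_tsum_ne_top htop (ε := ENNReal.ofReal (a / 2))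
      (by simpa using ha)
    refine Set.infinite_univ (α := ι) ((h.union hfin).subset fun i _ => ?_)
    rcases lt_or_ge (inner ℝ (e i) (A (e i))) (a / 2) with hi | hi
    · exact Or.inr hi
    · exact Or.inl (ENNReal.ofReal_le_ofReal hi)
  rw [opTrace, hpos, EReal.coe_ennreal_top]
  lift ∑' i, ENNReal.ofReal (-inner ℝ (e i) (A (e i))) to NNReal using hneg with x
  exact EReal.top_sub_coe _

/-- The trace of a product of two Hilbert-Schmidt operators is well defined and symmetric. -/
theorem exists_hasSum_inner_mul_comm (e : HilbertBasis ι ℝ H) {A B : H →L[ℝ] H}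
    (hA : IsHilbertSchmidt A) (hB : IsHilbertSchmidt B) :
    ∃ t : ℝ, HasSum (fun i => inner ℝ (e i) ((A * B) (e i))) t ∧
      HasSum (fun i => inner ℝ (e i) ((B * A) (e i))) t := by
  have hsq : ∀ {A : H →L[ℝ] H}, IsHilbertSchmidt A →
      Summable fun p : ι × ι => inner ℝ (e p.2) (A (e p.1)) ^ 2 := by
    intro A hA
    have h := hA.summable e
    rw [summable_iff_tsum_ofReal_ne_top fun i => sq_nonneg _] at h ⊢
    rw [ENNReal.tsum_prod']
    simpa only [tsum_ofReal_inner_sq e] using h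
  have hrow : ∀ (A B : H →L[ℝ] H) (i : ι),
      HasSum (fun j => inner ℝ (e i) (A (e j)) * inner ℝ (e j) (B (e i)))
        (inner ℝ (e i) ((A * B) (e i))) := by
    intro A B i
    have h := e.hasSum_inner_mul_inner (ContinuousLinearMap.adjoint A (e i)) (B (e i))
    simp only [ContinuousLinearMap.adjoint_inner_left] at h
    exact h
  have hs : Summable fun p : ι × ι =>
      inner ℝ (e p.1) (A (e p.2)) * inner ℝ (e p.2) (B (e p.1)) := by
    have h1 : Summable fun p : ι × ι => inner ℝ (e p.1) (A (e p.2)) ^ 2 :=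
      (Equiv.prodComm ι ι).summable_iff.mpr (hsq hA)
    refine Summable.of_norm_bounded (h1.add (hsq hB)) fun p => ?_
    rw [norm_mul, Real.norm_eq_abs, Real.norm_eq_abs, ← sq_abs (inner ℝ (e p.1) _),
      ← sq_abs (inner ℝ (e p.2) _)]
    nlinarith [sq_nonneg (|inner ℝ (e p.1) (A (e p.2))| - |inner ℝ (e p.2) (B (e p.1))|),
      sq_nonneg (|inner ℝ (e p.1) (A (e p.2))| + |inner ℝ (e p.2) (B (e p.1))|)]
  refine ⟨_, hs.hasSum.prod_fiberwise (hrow A B), ?_⟩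
  have h2 := (Equiv.prodComm ι ι).hasSum_iff.mpr hs.hasSum
  refine h2.prod_fiberwise fun i => (hrow B A i).congr_fun fun j => ?_
  exact mul_comm _ _

/-- Commutators of extended Hilbert-Schmidt operators have trace zero. -/
theorem IsExtHS.hasSum_commutator (e : HilbertBasis ι ℝ H) {A B : H →L[ℝ] H} {a b : ℝ}
    (hA : IsExtHS A a) (hB : IsExtHS B b) :
    HasSum (fun i => inner ℝ (e i) ((A * B - B * A) (e i))) 0 := by
  -- Scalars are central, so `[A, B] = [A - a, B - b]`, a commutator of Hilbert–Schmidt operators.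
  obtain ⟨t, h1, h2⟩ := exists_hasSum_inner_mul_comm e hA hB
  have h := h1.sub h2
  rw [sub_self] at h
  refine h.congr_fun fun i => ?_
  rw [← inner_sub_right, ← sub_apply]
  congr 2
  simp only [sub_mul, mul_sub, smul_mul_assoc, mul_smul_comm, mul_one, one_mul]
  module

end Trace

/-! ### Optimality of the polar factor. -/

section Optimal

variable {H : Type*} [NormedAddCommGroup H] [InnerProductSpace ℝ H] [CompleteSpace H]
  {R Q N P W V : H →L[ℝ] H}

/-- The decomposition of the Procrustes cost into the Bures-Wasserstein term, commutators and a
positive operator. -/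
theorem star_mul_mul_decomposition (hR : star R = R) (hQ : star Q = Q) (hN : star N = N)
    (hP : star P = P) (hWP : W * P = Q * N * R) (hW : star W * W = 1) (hV : V * star V = 1) :
    star (R - Q * V) * N * (R - Q * V) =
      (N * (R * R) + N * (Q * Q) - (2 : ℝ) • P) +
        star (1 - star W * V) * P * (1 - star W * V) +
        ((R * (N * R) - (N * R) * R) + (Q * (N * Q) - (N * Q) * Q) +
          (star V * (Q * N * Q * V) - (Q * N * Q * V) * star V) +
          ((P * (star W * V)) * star (star W * V) - star (star W * V) * (P * (star W * V)))) := by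
  -- The adjoint of the polar decomposition turns both cross terms into `P Z` and `Z* P` with `Z =
  -- W* V`.
  have hPW : P * star W = R * N * Q := by
    have := congrArg star hWP
    simpa [hP, hQ, hN, hR, mul_assoc] using this
  have hZ : (star W * V) * star (star W * V) = 1 := by
    rw [star_mul, star_star, mul_assoc, ← mul_assoc V, hV, one_mul, hW]
  have hPZ : P * (star W * V) * star (star W * V) = P := by rw [mul_assoc, hZ, mul_one]
  have hQV : Q * N * Q * V * star V = Q * N * Q := by rw [mul_assoc _ V, hV, mul_one]
  have hZs : star (star W * V) = star V * W := by rw [star_mul, star_star]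
  have h1 : R * N * Q * V = P * (star W * V) := by rw [← hPW, mul_assoc]
  have h2 : star V * (Q * N * R) = star (star W * V) * P := by rw [← hWP, hZs, mul_assoc]
  rw [hPZ, hQV, star_sub, star_sub, star_mul, star_one, hR, hQ, two_smul]
  calc (R - star V * Q) * N * (R - Q * V)
      = R * N * R + star V * (Q * N * Q * V) - R * N * Q * V - star V * (Q * N * R) := by
        noncomm_ring
    _ = _ := by
        rw [h1, h2]
        generalize star W * V = Z
        noncomm_ring

variable {ι : Type*} (e : HilbertBasis ι ℝ H) {r q n p w v : ℝ}

/-- Up to an operator of trace zero, the Procrustes cost is the Bures-Wasserstein term plus a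
positive operator. -/
theorem hasSum_cost_sub (hR : star R = R) (hQ : star Q = Q) (hN : star N = N)
    (hP : star P = P) (hWP : W * P = Q * N * R) (hW : star W * W = 1) (hV : V * star V = 1)
    (hRe : IsExtHS R r) (hQe : IsExtHS Q q) (hNe : IsExtHS N n) (hPe : IsExtHS P p)
    (hWe : IsExtHS W w) (hVe : IsExtHS V v) :
    HasSum (fun i => inner ℝ (e i) ((star (R - Q * V) * N * (R - Q * V)) (e i)) -
      (inner ℝ (e i) ((N * (R * R) + N * (Q * Q) - (2 : ℝ) • P) (e i)) +
        inner ℝ (e i) ((star (1 - star W * V) * P * (1 - star W * V)) (e i)))) 0 := by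
  have hZe := hWe.star.mul hVe
  have h := (((hRe.hasSum_commutator e (hNe.mul hRe)).add
    (hQe.hasSum_commutator e (hNe.mul hQe))).add
    (hVe.star.hasSum_commutator e (((hQe.mul hNe).mul hQe).mul hVe))).add
    ((hPe.mul hZe).hasSum_commutator e hZe.star)
  simp only [add_zero] at h
  refine h.congr_fun fun i => ?_
  rw [star_mul_mul_decomposition hR hQ hN hP hWP hW hV]
  simp only [add_apply, inner_add_right]
  ring

theorem inner_star_mul_mul (A B : H →L[ℝ] H) (x : H) :
    inner ℝ x ((star B * A * B) x) = inner ℝ (B x) (A (B x)) :=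
  ContinuousLinearMap.adjoint_inner_right B x (A (B x))

theorem IsPosDef.inner_star_mul_mul_nonneg {A : H →L[ℝ] H} (hA : IsPosDef A) (B : H →L[ℝ] H)
    (x : H) : 0 ≤ inner ℝ x ((star B * A * B) x) := by
  rw [inner_star_mul_mul]
  exact hA.inner_nonneg _

/-- The form of `A` is comparable to `‖·‖²` from both sides. With `A = N` this says that a
Procrustes cost is finite exactly when `R - Q V` is Hilbert–Schmidt. -/
theorem IsPosDef.summable_iff {A : H →L[ℝ] H} (hA : IsPosDef A) (B : H →L[ℝ] H) :
    Summable (fun i => inner ℝ (e i) ((star B * A * B) (e i))) ↔ IsHilbertSchmidt B := by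
  simp_rw [inner_star_mul_mul]
  constructor
  · intro h
    obtain ⟨-, c, hc, hA⟩ := hA
    refine isHilbertSchmidt_of_summable e ((h.mul_left c⁻¹).of_nonneg_of_le
      (fun i => sq_nonneg _) fun i => ?_)
    rw [le_inv_mul_iff₀ hc]
    exact hA _
  · intro h
    refine ((h.summable e).mul_left ‖A‖).of_nonneg_of_le (fun i => hA.inner_nonneg _) fun i => ?_
    calc inner ℝ (B (e i)) (A (B (e i))) ≤ ‖B (e i)‖ * ‖A (B (e i))‖ := real_inner_le_norm _ _
      _ ≤ ‖B (e i)‖ * (‖A‖ * ‖B (e i)‖) := by gcongr; exact A.le_opNorm _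
      _ = ‖A‖ * ‖B (e i)‖ ^ 2 := by ring

/-- The unitary polar factor `W` minimizes the Procrustes cost, and its cost is the trace of the
Bures-Wasserstein term. -/
theorem polar_factor_minimizes (hR : IsPosDef R) (hQ : IsPosDef Q) (hN : IsPosDef N)
    (hP : IsPosDef P) (hWP : W * P = Q * N * R) (hW : W ∈ unitary (H →L[ℝ] H))
    (hRe : IsExtHS R r) (hQe : IsExtHS Q q) (hNe : IsExtHS N n) (hPe : IsExtHS P p)
    (hWe : IsExtHS W w) (hL : IsHilbertSchmidt (R - Q * W)) :
    (Summable fun i => inner ℝ (e i) ((N * (R * R) + N * (Q * Q) - (2 : ℝ) • P) (e i))) ∧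
    0 ≤ ∑' i, inner ℝ (e i) ((N * (R * R) + N * (Q * Q) - (2 : ℝ) • P) (e i)) ∧
    ∑' i, ENNReal.ofReal (inner ℝ (e i) ((star (R - Q * W) * N * (R - Q * W)) (e i))) =
      ENNReal.ofReal
        (∑' i, inner ℝ (e i) ((N * (R * R) + N * (Q * Q) - (2 : ℝ) • P) (e i))) ∧
    ∀ V ∈ unitary (H →L[ℝ] H),
      ENNReal.ofReal
        (∑' i, inner ℝ (e i) ((N * (R * R) + N * (Q * Q) - (2 : ℝ) • P) (e i))) ≤
      ∑' i, ENNReal.ofReal (inner ℝ (e i) ((star (R - Q * V) * N * (R - Q * V)) (e i))) := by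
  obtain ⟨hW1, hW2⟩ := Unitary.mem_iff.mp hW
  have hsW := (hN.summable_iff e _).mpr hL
  -- At `V = W` the positive term vanishes, so summability of the cost passes to the diagonal of the
  -- Bures–Wasserstein operator.
  have hWsum := hasSum_cost_sub e hR.1 hQ.1 hN.1 hP.1 hWP hW1 hW2 hRe hQe hNe hPe hWe hWe
  have hzero : ∀ x, (star (1 - star W * W) * P * (1 - star W * W)) x = 0 := fun x => by
    simp [hW1]
  simp only [hzero, inner_zero_right, add_zero] at hWsum
  have hg := (hsW.hasSum.sub hWsum)
  simp only [sub_sub_cancel, sub_zero] at hg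
  have hEq : ∑' i, ENNReal.ofReal (inner ℝ (e i) ((star (R - Q * W) * N * (R - Q * W)) (e i))) =
      ENNReal.ofReal
        (∑' i, inner ℝ (e i) ((N * (R * R) + N * (Q * Q) - (2 : ℝ) • P) (e i))) := by
    rw [hg.tsum_eq, ENNReal.ofReal_tsum_of_nonneg (fun i => hN.inner_star_mul_mul_nonneg _ _) hsW]
  refine ⟨hg.summable, ?_, hEq, fun V hV => ?_⟩
  · rw [hg.tsum_eq]
    exact tsum_nonneg fun i => hN.inner_star_mul_mul_nonneg _ _
  · by_cases htop : ∑' i, ENNReal.ofReal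
        (inner ℝ (e i) ((star (R - Q * V) * N * (R - Q * V)) (e i))) = ⊤
    · rw [htop]
      exact le_top
    have hsV := (summable_iff_tsum_ofReal_ne_top
      fun i => hN.inner_star_mul_mul_nonneg (R - Q * V) (e i)).mpr htop
    have hLV := (hN.summable_iff e _).mp hsV
    -- Finite cost puts `V = Q⁻¹ (R - (R - Q V))` in the extended algebra, as the commutator
    -- argument requires.
    have hVe : IsExtHS V (q⁻¹ * (r - 0)) := by
      have h := (hQe.inverse hQ.isUnit).mul (hRe.sub (isExtHS_zero_iff.mpr hLV))
      rwa [sub_sub_cancel, ← mul_assoc, Ring.inverse_mul_cancel _ hQ.isUnit, one_mul] at h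
    obtain ⟨-, hV2⟩ := Unitary.mem_iff.mp hV
    have hVsum := hasSum_cost_sub e hR.1 hQ.1 hN.1 hP.1 hWP hW1 hV2 hRe hQe hNe hPe hWe hVe
    have hE := (hsV.hasSum.sub hg.summable.hasSum).sub hVsum
    simp only [sub_zero] at hE
    have hE0 := hasSum_le (fun i => ?_) hasSum_zero hE
    · rw [← ENNReal.ofReal_tsum_of_nonneg (fun i => hN.inner_star_mul_mul_nonneg _ _) hsV]
      exact ENNReal.ofReal_le_ofReal (sub_nonneg.mp hE0)
    · have := hP.inner_star_mul_mul_nonneg (1 - star W * V) (e i)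
      linarith

/-- If the Procrustes cost of some unitary is finite in infinite dimension, then the scalar parts
agree. -/
theorem eq_of_isHilbertSchmidt_sub (hfd : ¬ FiniteDimensional ℝ H) (hV : V ∈ unitary (H →L[ℝ] H))
    (hQ : IsPosDef Q) (hRe : IsExtHS R r) (hQe : IsExtHS Q q) (hr : 0 ≤ r) (hq : 0 < q)
    (hL : IsHilbertSchmidt (R - Q * V)) : r = q := by
  obtain ⟨s, e, -⟩ := exists_hilbertBasis ℝ H
  have hinf : Infinite s := by
    rw [← not_finite_iff_infinite]
    exact fun _ => hfd (finiteDimensional_of_finite_index e)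
  have hVe : IsExtHS V (q⁻¹ * (r - 0)) := by
    have h := (hQe.inverse hQ.isUnit).mul (hRe.sub (isExtHS_zero_iff.mpr hL))
    rwa [sub_sub_cancel, ← mul_assoc, Ring.inverse_mul_cancel _ hQ.isUnit, one_mul] at h
  have hlim := hVe.tendsto_norm_sub e
  -- `V` preserves norms and is asymptotically `r / q ≥ 0` along the basis, so `r / q = 1`.
  have hle : |1 - q⁻¹ * (r - 0)| ≤ 0 := by
    refine ge_of_tendsto hlim (Filter.Eventually.of_forall fun i => ?_)
    have h1 : ‖V (e i)‖ = 1 := by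
      rw [ContinuousLinearMap.norm_map_of_mem_unitary hV, e.orthonormal.norm_eq_one]
    have h2 : ‖(q⁻¹ * (r - 0)) • e i‖ = q⁻¹ * (r - 0) := by
      rw [norm_smul, e.orthonormal.norm_eq_one, mul_one, Real.norm_eq_abs, sub_zero]
      exact abs_of_nonneg (by positivity)
    have h3 := abs_norm_sub_norm_le (V (e i)) ((q⁻¹ * (r - 0)) • e i)
    rwa [h1, h2] at h3
  have h0 := abs_nonpos_iff.mp hle
  field_simp at h0
  linarith

/-- The polar factor of an invertible operator is unitary. -/
theorem mul_inverse_mem_unitary {C : H →L[ℝ] H} (hC : IsUnit C) (hP : IsPosDef P)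
    (hPC : P * P = star C * C) : C * Ring.inverse P ∈ unitary (H →L[ℝ] H) := by
  have hu := hP.isUnit
  have h1 : star (C * Ring.inverse P) * (C * Ring.inverse P) = 1 := by
    rw [star_mul, hP.inverse.1.star_eq, mul_assoc, ← mul_assoc (star C), ← hPC, mul_assoc P,
      Ring.mul_inverse_cancel _ hu, mul_one, Ring.inverse_mul_cancel _ hu]
  obtain ⟨u, hu'⟩ := hC.mul hu.ringInverse
  rw [← hu'] at h1 ⊢
  -- An invertible isometry is unitary: its left inverse `star u` is its inverse.
  have h2 : star (u : H →L[ℝ] H) = (↑u⁻¹ : H →L[ℝ] H) := Units.eq_inv_of_mul_eq_one_right h1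
  exact Unitary.mem_iff.mpr ⟨h1, by rw [h2, Units.mul_inv]⟩

end Optimal

/-! ### The cost at `α = 1/2` and the theorem. -/

section Main

variable {H : Type*} [NormedAddCommGroup H] [InnerProductSpace ℝ H] [CompleteSpace H]
  {ι : Type*} (e : HilbertBasis ι ℝ H)

/-- The factor `α⁻¹ = 2` enters the quadratic expression as 4 and leaves the square root as 2. -/
theorem procrustesCost_half {M S T U : H →L[ℝ] H} {ρ : ℝ} (hN : IsPosDef (weight M ρ)) :
    procrustesCost e M ρ (1 / 2) S T U =
      2 * (∑' i, ENNReal.ofReal (inner ℝ (e i)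
        ((star (opPow S (1 / 2) - opPow T (1 / 2) * (1 + U)) * weight M ρ *
          (opPow S (1 / 2) - opPow T (1 / 2) * (1 + U))) (e i)))) ^ (1 / 2 : ℝ) := by
  rw [procrustesCost, extMahalanobisNorm]
  set L := opPow S (1 / 2) - opPow T (1 / 2) * (1 + U)
  have h1 : ContinuousLinearMap.adjoint ((1 / 2 : ℝ)⁻¹ • L) * weight M ρ * ((1 / 2 : ℝ)⁻¹ • L) =
      (4 : ℝ) • (star L * weight M ρ * L) := by
    rw [← ContinuousLinearMap.star_eq_adjoint, star_smul, smul_mul_assoc, smul_mul_assoc,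
      mul_smul_comm, smul_smul]
    norm_num
  have h2 : ∀ i, inner ℝ (e i) (((4 : ℝ) • (star L * weight M ρ * L)) (e i)) =
      4 * inner ℝ (e i) ((star L * weight M ρ * L) (e i)) := fun i => by
    rw [smul_apply, inner_smul_right]
  have h3 := fun i => hN.inner_star_mul_mul_nonneg L (e i)
  rw [h1, toENNReal_opTrace_of_nonneg e fun i => by rw [h2]; exact mul_nonneg (by norm_num) (h3 i)]
  simp_rw [h2, ENNReal.ofReal_mul (by norm_num : (0 : ℝ) ≤ 4)]
  rw [ENNReal.tsum_mul_left, ENNReal.mul_rpow_of_nonneg _ _ (by norm_num)]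
  congr 1
  rw [ENNReal.ofReal_rpow_of_pos (by norm_num), ← Real.sqrt_eq_rpow,
    show (4 : ℝ) = 2 ^ 2 by norm_num, Real.sqrt_sq (by norm_num)]
  simp

theorem IsPosDefExtHS.finiteDimensional {X : H →L[ℝ] H} (hX : IsPosDefExtHS X 0) :
    FiniteDimensional ℝ H := by
  obtain ⟨-, hHS, -, hpos⟩ := hX
  rw [zero_smul, add_zero] at hpos
  have h := hHS.mul_left (Ring.inverse X)
  rwa [Ring.inverse_mul_cancel _ hpos.isUnit, isHilbertSchmidt_one_iff] at h

/-- If `δ = 0`, then `X` itself is an invertible Hilbert–Schmidt operator, which forces finite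
dimension. -/
theorem IsPosDefExtHS.pos {X : H →L[ℝ] H} {δ : ℝ} (hX : IsPosDefExtHS X δ)
    (hfd : ¬ FiniteDimensional ℝ H) : 0 < δ := by
  refine lt_of_le_of_ne hX.2.2.1 ?_
  rintro rfl
  exact hfd hX.finiteDimensional

end Main

end ProcrustesGBW

open ProcrustesGBW in
theorem corollary3p1 {H : Type*} [NormedAddCommGroup H] [InnerProductSpace ℝ H] [CompleteSpace H]
    [TopologicalSpace.SeparableSpace H] {ι : Type*} (e : HilbertBasis ι ℝ H)
    (X Y M : H →L[ℝ] H) (δ γ ρ : ℝ) (hρ : 0 < ρ)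
    (hX : ProcrustesGBW.IsPosDefExtHS X δ) (hY : ProcrustesGBW.IsPosDefExtHS Y γ)
    (hM : ProcrustesGBW.IsPosDefExtHS M ρ) :
    -- the radicand of the generalised Bures-Wasserstein distance is well defined and nonnegative
    0 ≤ ProcrustesGBW.gbwSq e M ρ (X + δ • 1) (Y + γ • 1) ∧
    -- the infimum in the Procrustes distance for `α = 1/2` is a minimum
    (∃ U : H →L[ℝ] H, 1 + U ∈ unitary (H →L[ℝ] H) ∧
      ProcrustesGBW.procrustesCost e M ρ (1 / 2) (X + δ • 1) (Y + γ • 1) U =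
        ProcrustesGBW.procrustesDist e M ρ (1 / 2) (X + δ • 1) (Y + γ • 1)) ∧
    ProcrustesGBW.procrustesDist e M ρ (1 / 2) (X + δ • 1) (Y + γ • 1) =
      2 * ProcrustesGBW.gbwDist e M ρ (X + δ • 1) (Y + γ • 1) ∧
    -- the cases in which the common value is a real number
    (ProcrustesGBW.gbwDist e M ρ (X + δ • 1) (Y + γ • 1) < ⊤ ↔
      FiniteDimensional ℝ H ∨ δ = γ) := by
  obtain ⟨-, hXH, hδ, hS⟩ := id hX
  obtain ⟨-, hYH, hγ, hT⟩ := id hY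
  obtain ⟨-, hMH, -, hMp⟩ := id hM
  have hSe := hXH.isExtHS δ
  have hTe := hYH.isExtHS γ
  have hN : IsPosDef (weight M ρ) := hMp.inverse
  have hNe : IsExtHS (weight M ρ) ρ⁻¹ := (hMH.isExtHS ρ).inverse hMp.isUnit
  set S := X + δ • (1 : H →L[ℝ] H)
  set T := Y + γ • (1 : H →L[ℝ] H)
  have hcost := fun U => procrustesCost_half e (S := S) (T := T) (U := U) hN
  have hG : gbwSq e M ρ S T = opTrace e (weight M ρ * S + weight M ρ * T - (2 : ℝ) •
    opPow (opPow S (1 / 2) * weight M ρ * T * weight M ρ * opPow S (1 / 2)) (1 / 2)) := rfl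
  have hR := hS.isPosDef_opPow_half hSe
  have hRe := hS.isExtHS_opPow_half hδ hSe
  have hRR := hS.opPow_half_mul_self hSe
  have hQ := hT.isPosDef_opPow_half hTe
  have hQe := hT.isExtHS_opPow_half hγ hTe
  have hQQ := hT.opPow_half_mul_self hTe
  set R := opPow S (1 / 2)
  set Q := opPow T (1 / 2)
  set N := weight M ρ
  have hCu : IsUnit (Q * N * R) := (hQ.isUnit.mul hN.isUnit).mul hR.isUnit
  have hCe : IsExtHS (Q * N * R) (√γ * ρ⁻¹ * √δ) := (hQe.mul hNe).mul hRe
  have hCC : R * N * T * N * R = star (Q * N * R) * (Q * N * R) := by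
    simp only [star_mul, hR.1.star_eq, hQ.1.star_eq, hN.1.star_eq, ← hQQ, mul_assoc]
  have hCCe : IsExtHS (R * N * T * N * R) ((√γ * ρ⁻¹ * √δ) * (√γ * ρ⁻¹ * √δ)) := by
    rw [hCC]
    exact hCe.star.mul hCe
  have hCCp : IsPosDef (R * N * T * N * R) := by
    rw [hCC]
    simpa using isPosDef_one.star_mul_mul hCu
  have hP := hCCp.isPosDef_opPow_half hCCe
  have hPe := hCCp.isExtHS_opPow_half (mul_self_nonneg _) hCCe
  rw [Real.sqrt_mul_self (by positivity)] at hPe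
  have hPP := hCCp.opPow_half_mul_self hCCe
  set P := opPow (R * N * T * N * R) (1 / 2)
  rw [hCC] at hPP
  have hW := mul_inverse_mem_unitary hCu hP hPP
  have hWe := hCe.mul (hPe.inverse hP.isUnit)
  have hWP : Q * N * R * Ring.inverse P * P = Q * N * R := by
    rw [mul_assoc, Ring.inverse_mul_cancel _ hP.isUnit, mul_one]
  set W := Q * N * R * Ring.inverse P
  by_cases hfin : FiniteDimensional ℝ H ∨ δ = γ
  · have hL : IsHilbertSchmidt (R - Q * W) := by
      by_cases hfd : FiniteDimensional ℝ H
      · exact isHilbertSchmidt_of_finiteDimensional _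
      · obtain rfl := hfin.resolve_left hfd
        have hpos : 0 < √δ := Real.sqrt_pos.mpr (hX.pos hfd)
        -- `W` has scalar part `c * c⁻¹` with `c = √δ ρ⁻¹ √δ > 0`, so the scalar parts of `R` and `Q
        -- W` cancel.
        have h := hRe.sub (hQe.mul hWe)
        rw [mul_inv_cancel₀ (by positivity), mul_one, sub_self] at h
        exact isExtHS_zero_iff.mp h
    obtain ⟨hsum, hnonneg, hmin, hle⟩ :=
      polar_factor_minimizes e hR hQ hN hP hWP hW hRe hQe hNe hPe hWe hL
    rw [hRR, hQQ] at hsum hnonneg hmin hle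
    set g := ∑' i, inner ℝ (e i) ((N * S + N * T - (2 : ℝ) • P) (e i))
    have hGg : gbwSq e M ρ S T = (g : EReal) := hG.trans (opTrace_eq_tsum e hsum)
    have hdist : gbwDist e M ρ S T = ENNReal.ofReal g ^ (1 / 2 : ℝ) := by
      rw [gbwDist, hGg, EReal.real_coe_toENNReal]
    have hWcost : procrustesCost e M ρ (1 / 2) S T (W - 1) = 2 * gbwDist e M ρ S T := by
      rw [hcost, hdist, add_sub_cancel, hmin]
    have heq : procrustesDist e M ρ (1 / 2) S T = 2 * gbwDist e M ρ S T := by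
      refine le_antisymm ?_ (le_iInf₂ fun U hU => ?_)
      · rw [← hWcost]
        exact iInf₂_le (W - 1) (by rwa [add_sub_cancel])
      · rw [hcost, hdist]
        gcongr
        exact hle _ hU
    refine ⟨?_, ⟨W - 1, by rwa [add_sub_cancel], hWcost.trans heq.symm⟩, heq, ?_⟩
    · rw [hGg]
      exact_mod_cast hnonneg
    · simp only [hfin, iff_true]
      rw [hdist]
      exact ENNReal.rpow_lt_top_of_nonneg (by norm_num) ENNReal.ofReal_ne_top
  · obtain ⟨hfd, hne⟩ := not_or.mp hfin
    have hδ' := hX.pos hfd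
    have hγ' := hY.pos hfd
    have hsqrt : √δ ≠ √γ := fun h => hne ((Real.sqrt_inj hδ hγ).mp h)
    have hGtop : gbwSq e M ρ S T = ⊤ := by
      refine hG.trans ((((hNe.mul hSe).add (hNe.mul hTe)).sub (hPe.smul 2)).opTrace_eq_top
        ?_ hfd e)
      -- The scalar part of the Bures–Wasserstein operator is a perfect square, positive exactly
      -- because `δ ≠ γ`.
      have h : ρ⁻¹ * δ + ρ⁻¹ * γ - 2 * (√γ * ρ⁻¹ * √δ) = ρ⁻¹ * (√δ - √γ) ^ 2 := by
        rw [sub_sq, Real.sq_sqrt hδ, Real.sq_sqrt hγ]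
        ring
      rw [h]
      have := sq_pos_of_ne_zero (sub_ne_zero.mpr hsqrt)
      positivity
    have hdist : gbwDist e M ρ S T = ⊤ := by
      rw [gbwDist, hGtop, EReal.toENNReal_top, ENNReal.top_rpow_of_pos (by norm_num)]
    have hctop : ∀ U, 1 + U ∈ unitary (H →L[ℝ] H) →
        procrustesCost e M ρ (1 / 2) S T U = ⊤ := by
      intro U hU
      rw [hcost]
      have htop : ∑' i, ENNReal.ofReal
          (inner ℝ (e i) ((star (R - Q * (1 + U)) * N * (R - Q * (1 + U))) (e i))) = ⊤ := by
        by_contra hne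
        have hs := (summable_iff_tsum_ofReal_ne_top
          fun i => hN.inner_star_mul_mul_nonneg (R - Q * (1 + U)) (e i)).mpr hne
        exact hsqrt (eq_of_isHilbertSchmidt_sub hfd hU hQ hRe hQe (Real.sqrt_nonneg _)
          (Real.sqrt_pos.mpr hγ') ((hN.summable_iff e _).mp hs))
      rw [htop, ENNReal.top_rpow_of_pos (by norm_num), ENNReal.mul_top (by norm_num)]
    have hdtop : procrustesDist e M ρ (1 / 2) S T = ⊤ :=
      top_le_iff.mp (le_iInf₂ fun U hU => (hctop U hU).ge)
    -- Every unitary has infinite cost here, so any one attains the infimum; the identity is chosen.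
    have hone : 1 + (0 : H →L[ℝ] H) ∈ unitary (H →L[ℝ] H) := by
      rw [add_zero]
      exact one_mem _
    refine ⟨by rw [hGtop]; exact le_top, ⟨0, hone, (hctop 0 hone).trans hdtop.symm⟩, ?_, ?_⟩
    · rw [hdtop, hdist, ENNReal.mul_top (by norm_num)]
    · simp [hdist, hfin]
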